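/- Let $d\ge 1$ be an integer and let $\alpha,\beta,\sigma,\zeta$ be real numbers with $0<\alpha<\beta<1/2$ and $\sigma>0$. For $n\ge 1$ let $T_n^d=(\mathbb{Z}/n\mathbb{Z})^d$ be the $d$-dimensional lattice torus, regarded as a graph in which two sites are adjacent if they differ by $\pm1$ (modulo $n$) in exactly one coordinate, and let $d_\infty^T(u,v)=\max_{1\le i\le d}\min_{k\in\mathbb{Z}}|u_i-v_i+kn|$ be its $\ell_\infty$ metric. The modified Newman–Watts graph $G_n=G_n(\alpha,\beta,\sigma,\zeta)$ is the random graph obtained from $T_n^d$ by adding, independently for each unordered pair $\{u,v\}$ of sites with $\alpha n\le d_\infty^T(u,v)\le\beta n$, the long edge $\{u,v\}$ with probability $p_n=\sigma n^{-d}(\ln n)^{\zeta}$ (which lies in $[0,1]$ for all large $n$; for the remaining $n$ it is truncated to $[0,1]$). Let $\mathrm{diam}(G_n)$ be its graph diameter. **A.** Suppose $\Gamma:=(2\beta)^d-(2\alpha)^d>1/2$. (i) If $0<\zeta<1$ and $\sigma>0$, or if $\zeta=0$ and $\sigma\ge\sigma_0$ for some constant $\sigma_0=\sigma_0(d,\alpha,\beta)>0$,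 then there is a constant $C_1=C_1(d,\alpha,\beta,\sigma,\zeta)>0$ such that $$\lim_{n\to\infty}\mathbb{P}\big(\mathrm{diam}(G_n)\le C_1\ln^3 n\big)=1.$$ (ii) If $\zeta>1$ and $\sigma>0$, or if $\zeta=1$ and $\sigma\ge\sigma_0'$ for some constant $\sigma_0'=\sigma_0'(d,\alpha,\beta)>0$, then there is a constant $C_2=C_2(d,\alpha,\beta,\sigma,\zeta)>0$ such that $$\lim_{n\to\infty}\mathbb{P}\big(\mathrm{diam}(G_n)\le C_2\ln^2 n\big)=1.$$ **B.** Suppose $\zeta<1$ ($\zeta$ may be negative; no condition on $\Gamma$ is needed). Then for every $\sigma>0$ and every $\nu$ with $0<\nu<(1-\zeta)/d$, $$\lim_{n\to\infty}\mathbb{P}\big(\mathrm{diam}(G_n)\ge \ln^{\nu} n\big)=1.$$ Furthermore, there is a constant $\sigma_1=\sigma_1(d,\alpha,\beta,\zeta)>0$ such that for every $0<\sigma\le\sigma_1$, $$\lim_{n\to\infty}\mathbb{P}\big(\mathrm{diam}(G_n)\ge \ln^{(1-\zeta)/d} n\big)=1.$$ -/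

import Mathlib

open Filter Topology MeasureTheory ProbabilityTheory

namespace ModifiedNewmanWatts

/-- The vertex set of the `d`-dimensional lattice torus with `n ^ d` sites. -/
abbrev Torus (d n : ℕ) : Type := Fin d → ZMod n

/-- The `l_∞` metric on the torus: the maximum over the coordinates of the cyclic distance
`min_{k} |u_i - v_i + k n|`. -/
def torusDist {d n : ℕ} (u v : Torus d n) : ℕ :=
  Finset.univ.sup fun i => (u i - v i).valMinAbs.natAbs

theorem torusDist_comm {d n : ℕ} (u v : Torus d n) : torusDist u v = torusDist v u := by
  unfold torusDist
  congr 1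
  funext i
  rw [← neg_sub (v i) (u i), ZMod.natAbs_valMinAbs_neg]

/-- The nearest-neighbour graph of the lattice torus: two sites are adjacent when they differ
by one (cyclically) in exactly one coordinate. -/
def torusGraph (d n : ℕ) : SimpleGraph (Torus d n) :=
  SimpleGraph.fromRel fun u v => ∃ i, v i = u i + 1 ∧ ∀ j, j ≠ i → v j = u j

/-- The graph of all pairs that are eligible for a long edge:
`α n ≤ torusDist u v ≤ β n`. -/
def longPairs (d n : ℕ) (α β : ℝ) : SimpleGraph (Torus d n) where
  Adj u v := u ≠ v ∧ α * n ≤ torusDist u v ∧ (torusDist u v : ℝ) ≤ β * n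
  symm := ⟨fun u v h => by rw [torusDist_comm v u]; exact ⟨h.1.symm, h.2⟩⟩
  loopless := ⟨fun _ h => h.1 rfl⟩

/-- The connection probability `p_n = σ n^{-d} (ln n)^ζ`, cut off to `[0, 1]` (the cut-off is
inactive for all large `n`). -/
noncomputable def longProb (d n : ℕ) (σ ζ : ℝ) : unitInterval :=
  Set.projIcc (0 : ℝ) 1 zero_le_one (σ * Real.log n ^ ζ / (n : ℝ) ^ d)

/-- The law of the random set of long edges: each eligible unordered pair belongs to it
independently with probability `longProb d n σ ζ`, and no other pair does. -/
noncomputable def longEdgeLaw (d n : ℕ) (α β σ ζ : ℝ) : Measure (Set (Sym2 (Torus d n))) :=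
  setBernoulli (longPairs d n α β).edgeSet (longProb d n σ ζ)

/-- The graph obtained from the lattice torus by adding the long edges in `L`. -/
def addLongEdges {d n : ℕ} (L : Set (Sym2 (Torus d n))) : SimpleGraph (Torus d n) :=
  torusGraph d n ⊔ SimpleGraph.fromEdgeSet L

/-- The probability that the diameter of the modified Newman-Watts graph
`G_n(α, β, σ, ζ)` has the property `P`. -/
noncomputable def probDiam (d n : ℕ) (α β σ ζ : ℝ) (P : ℕ → Prop) : ℝ :=
  (longEdgeLaw d n α β σ ζ).real {L | P (addLongEdges L).diam}

end ModifiedNewmanWatts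

/-! Lower bound. Place about `√n` disjoint balls of radius `r = ⌊ln^κ n⌋` within distance `α n` of
one another. An eligible edge is too long to join two of them, so the balls are touched by long
edges independently. The expected number of long edges at a ball is at most `σ 3^d ln^(κd+ζ) n`; if
this is at most `(ln n)/8`, a ball stays untouched with probability at least `n^(-1/4)`, and with
high probability some ball does. Only lattice steps are available inside it, so leaving it takes
more than `r` steps (`one_sub_le_prob_lt_diam`, `tendsto_probDiam_lower`).

Upper bound. Cut the torus into boxes of side of order `ln n`. A union `A` of boxes covering at most
half of the sites remains below the fraction `γ > 1/2` of eligible partners of each site, even after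
enlargement to a slightly bigger union `W`. Hence linearly many partners of every site of `A` lie
outside `W`, and the boxes are large enough that the chance of no long edge from `A` to the
complement of `W` beats the number of pairs `(A, W)` (`prob_not_isBlockExpanding_le`). So the set of
boxes reached from a site grows geometrically until it covers more than half of the torus, and two
such sets meet (`edist_le_of_isBlockExpanding`). There are `O(ln n)` rounds, each costing one long
edge and one box crossing of length `O(ln n)`: the diameter is `O(ln² n)`, which also gives the
cubic bound. -/

namespace ModifiedNewmanWatts

/-! ### Bernoulli random sets: avoidance probabilities and independence -/

section Bernoulli

variable {ι : Type*}

open Classical in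
theorem setBernoulli_real_avoid (u : Set ι) (p : unitInterval) (S : Finset ι) :
    (setBernoulli u p).real {L | ∀ e ∈ S, e ∉ L} =
      ∏ e ∈ S, (if e ∈ u then 1 - (p : ℝ) else 1) := by
  have h : (fun q : ι → Prop => {i | q i}) ⁻¹' {L | ∀ e ∈ S, e ∉ L} =
      Set.pi (S : Set ι) (fun _ => {False}) := by
    ext q
    simp [Set.mem_pi]
  rw [measureReal_def, setBernoulli_apply', h, Measure.infinitePi_pi _ (by simp),
    ENNReal.toReal_prod]
  refine Finset.prod_congr rfl fun e _ => ?_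
  by_cases he : e ∈ u
  · simp [he]
  · simp [he, ← ENNReal.coe_add]

theorem setBernoulli_real_avoid_of_subset (u : Set ι) (p : unitInterval) (S : Finset ι)
    (hS : ∀ e ∈ S, e ∈ u) :
    (setBernoulli u p).real {L | ∀ e ∈ S, e ∉ L} = (1 - (p : ℝ)) ^ S.card := by
  classical
  rw [setBernoulli_real_avoid, Finset.prod_congr rfl fun e he => if_pos (hS e he)]
  simp

/-- Avoiding several sets means avoiding their union, and the product formula for the union splits
along disjoint pieces. -/
theorem iIndepSet_avoid [Finite ι] {κ : Type*} (u : Set ι) (p : unitInterval) (S : κ → Finset ι)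
    (hS : Pairwise fun i j => Disjoint (S i) (S j)) :
    iIndepSet (fun i => {L : Set ι | ∀ e ∈ S i, e ∉ L}) (setBernoulli u p) := by
  classical
  rw [iIndepSet_iff_meas_biInter fun i => (Set.toFinite _).measurableSet]
  intro T
  have h : (⋂ i ∈ T, {L : Set ι | ∀ e ∈ S i, e ∉ L}) = {L | ∀ e ∈ T.biUnion S, e ∉ L} := by
    ext L
    simp only [Set.mem_iInter, Set.mem_ofPred_eq, Finset.mem_biUnion]
    grind
  rw [h, ← ENNReal.toReal_eq_toReal_iff' (measure_ne_top _ _)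
    (ENNReal.prod_ne_top fun _ _ => measure_ne_top _ _), ENNReal.toReal_prod]
  simp only [← measureReal_def, setBernoulli_real_avoid]
  exact Finset.prod_biUnion fun i _ j _ hij => hS hij

/-- The random set meets each of finitely many disjoint sets with at most the probability that
independent Bernoulli trials allow. -/
theorem setBernoulli_real_hit_all_le [Finite ι] {κ : Type*} [Fintype κ] (u : Set ι) (p : unitInterval)
    (S : κ → Finset ι) (hS : Pairwise fun i j => Disjoint (S i) (S j)) (K : ℕ)
    (hu : ∀ i, ∀ e ∈ S i, e ∈ u) (hK : ∀ i, (S i).card ≤ K) :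
    (setBernoulli u p).real {L | ∀ i, ∃ e ∈ S i, e ∈ L} ≤
      (1 - (1 - (p : ℝ)) ^ K) ^ Fintype.card κ := by
  have hind := ((iIndepSet_iff_iIndep _ _).1 (iIndepSet_avoid u p S hS)).meas_biInter
    (s := fun i => {L : Set ι | ∀ e ∈ S i, e ∉ L}ᶜ) (S := Finset.univ) fun i _ =>
      (MeasurableSpace.measurableSet_generateFrom (Set.mem_singleton _)).compl
  have h : {L : Set ι | ∀ i, ∃ e ∈ S i, e ∈ L} =
      ⋂ i ∈ (Finset.univ : Finset κ), {L : Set ι | ∀ e ∈ S i, e ∉ L}ᶜ := by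
    ext L
    simp
  rw [h, measureReal_def, hind, ENNReal.toReal_prod, Fintype.card, ← Finset.prod_const]
  refine Finset.prod_le_prod (fun _ _ => ENNReal.toReal_nonneg) fun i _ => ?_
  rw [← measureReal_def, probReal_compl_eq_one_sub (Set.toFinite _).measurableSet,
    setBernoulli_real_avoid_of_subset u p (S i) (hu i)]
  have := pow_le_pow_of_le_one (sub_nonneg.2 p.2.2) (by linarith [p.2.1]) (hK i)
  linarith

end Bernoulli

/-! ### The torus metric and ball volumes -/

section TorusMetric

variable {d n : ℕ}

theorem torusDist_le_iff {u v : Torus d n} {t : ℕ} :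
    torusDist u v ≤ t ↔ ∀ i, (u i - v i).valMinAbs.natAbs ≤ t := by
  simp [torusDist, Finset.sup_le_iff]

theorem natAbs_valMinAbs_sub_le_torusDist (u v : Torus d n) (i : Fin d) :
    (u i - v i).valMinAbs.natAbs ≤ torusDist u v :=
  torusDist_le_iff.1 le_rfl i

@[simp]
theorem torusDist_self (u : Torus d n) : torusDist u u = 0 :=
  Nat.le_zero.1 (torusDist_le_iff.2 fun i => by simp)

theorem torusDist_triangle (u v w : Torus d n) :
    torusDist u w ≤ torusDist u v + torusDist v w := by
  refine torusDist_le_iff.2 fun i => ?_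
  have h := ZMod.natAbs_valMinAbs_add_le (u i - v i) (v i - w i)
  rw [sub_add_sub_cancel] at h
  exact (h.trans (Int.natAbs_add_le _ _)).trans (add_le_add
    (natAbs_valMinAbs_sub_le_torusDist u v i) (natAbs_valMinAbs_sub_le_torusDist v w i))

theorem natAbs_valMinAbs_intCast_le [NeZero n] (k : ℤ) :
    ((k : ZMod n)).valMinAbs.natAbs ≤ k.natAbs := by
  refine ZMod.natAbs_min_of_le_div_two n _ _ ?_ (ZMod.natAbs_valMinAbs_le _)
  simp

theorem valMinAbs_intCast_eq [NeZero n] {k : ℤ} (hk : 2 * k.natAbs < n) :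
    ((k : ZMod n)).valMinAbs = k :=
  (ZMod.valMinAbs_spec _ _).2 ⟨rfl, by simp only [Set.mem_Ioc]; omega⟩

theorem torusDist_le_one_of_adj [NeZero n] {u v : Torus d n} (h : (torusGraph d n).Adj u v) :
    torusDist u v ≤ 1 := by
  have key : ∀ u v : Torus d n, (∃ i, v i = u i + 1 ∧ ∀ j, j ≠ i → v j = u j) →
      torusDist u v ≤ 1 := by
    rintro u v ⟨i, hi, hj⟩
    refine torusDist_le_iff.2 fun j => ?_
    by_cases hji : j = i
    · subst hji
      have := natAbs_valMinAbs_intCast_le (n := n) (-1)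
      rw [hi]
      simpa using this
    · simp [hj j hji]
  rcases (SimpleGraph.fromRel_adj _ _ _).1 h with ⟨-, h | h⟩
  · exact key u v h
  · rw [torusDist_comm]; exact key v u h

theorem card_valMinAbs_sub_le [NeZero n] (a : ZMod n) (t : ℕ) :
    (Finset.univ.filter fun x : ZMod n => (a - x).valMinAbs.natAbs ≤ t).card ≤ 2 * t + 1 := by
  have h : (Finset.Icc (-(t : ℤ)) t).card = 2 * t + 1 := by simp; omega
  rw [← h]
  refine Finset.card_le_card_of_injOn (fun x => (a - x).valMinAbs) ?_ ?_
  · intro x hx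
    simp only [Finset.coe_filter, Finset.mem_univ, true_and, Set.mem_ofPred_eq] at hx
    simp only [Finset.coe_Icc, Set.mem_Icc]
    omega
  · intro x _ y _ hxy
    simpa using hxy

theorem le_card_valMinAbs_sub_le [NeZero n] (a : ZMod n) {t : ℕ} (ht : 2 * t < n) :
    2 * t + 1 ≤ (Finset.univ.filter fun x : ZMod n => (a - x).valMinAbs.natAbs ≤ t).card := by
  have h : (Finset.Icc (-(t : ℤ)) t).card = 2 * t + 1 := by simp; omega
  rw [← h]
  have hk : ∀ k ∈ Finset.Icc (-(t : ℤ)) t, ((k : ZMod n)).valMinAbs = k := by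
    intro k hk
    rw [Finset.mem_Icc] at hk
    exact valMinAbs_intCast_eq (by omega)
  refine Finset.card_le_card_of_injOn (fun k => a - (k : ZMod n)) ?_ ?_
  · intro k hk'
    rw [Finset.mem_coe] at hk'
    simp only [Finset.coe_filter, Finset.mem_univ, true_and, Set.mem_ofPred_eq, sub_sub_cancel,
      hk k hk']
    rw [Finset.mem_Icc] at hk'
    omega
  · intro k hk' l hl' hkl
    have : ((k : ZMod n)).valMinAbs = ((l : ZMod n)).valMinAbs := by
      rw [sub_right_injective hkl]
    rwa [hk k hk', hk l hl'] at this

theorem filter_torusDist_le_eq_piFinset [NeZero n] (v : Torus d n) (t : ℕ) :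
    (Finset.univ.filter fun w => torusDist v w ≤ t) =
      Fintype.piFinset fun i => Finset.univ.filter fun x => (v i - x).valMinAbs.natAbs ≤ t := by
  ext w
  simp [torusDist_le_iff]

theorem card_torusDist_le [NeZero n] (v : Torus d n) (t : ℕ) :
    (Finset.univ.filter fun w => torusDist v w ≤ t).card ≤ (2 * t + 1) ^ d := by
  rw [filter_torusDist_le_eq_piFinset, Fintype.card_piFinset]
  refine (Finset.prod_le_pow_card _ _ _ fun i _ => card_valMinAbs_sub_le (v i) t).trans_eq ?_
  simp

theorem le_card_torusDist_le [NeZero n] (v : Torus d n) {t : ℕ} (ht : 2 * t < n) :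
    (2 * t + 1) ^ d ≤ (Finset.univ.filter fun w => torusDist v w ≤ t).card := by
  rw [filter_torusDist_le_eq_piFinset, Fintype.card_piFinset]
  refine le_trans (by simp) (Finset.pow_card_le_prod Finset.univ _ _
    fun i _ => le_card_valMinAbs_sub_le (v i) ht)

open Classical in
/-- A lower bound for the number of eligible partners of a site. -/
theorem le_card_longPairs_adj [NeZero n] {α β : ℝ} (hα : 0 < α) (hβ0 : 0 ≤ β)
    (hβ : β < 1 / 2) (hβn : 1 ≤ 2 * β * n) (v : Torus d n) :
    (2 * β * n - 1) ^ d - (2 * α * n + 1) ^ d ≤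
      ((Finset.univ.filter fun w => (longPairs d n α β).Adj v w).card : ℝ) := by
  -- The eligible partners contain the shell between the balls of radii `⌊α n⌋` and `⌊β n⌋`.
  have hn : (0 : ℝ) < n := by exact_mod_cast NeZero.pos n
  set B := Finset.univ.filter fun w => torusDist v w ≤ ⌊β * n⌋₊
  set A := Finset.univ.filter fun w => torusDist v w ≤ ⌊α * n⌋₊
  have hsub : B \ A ⊆ Finset.univ.filter fun w => (longPairs d n α β).Adj v w := by
    intro w hw
    simp only [A, B, Finset.mem_sdiff, Finset.mem_filter, Finset.mem_univ, true_and, not_le,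
      Nat.le_floor_iff (by positivity : 0 ≤ β * n), Nat.floor_lt (by positivity : 0 ≤ α * n)]
      at hw ⊢
    refine ⟨?_, hw.2.le, hw.1⟩
    rintro rfl
    have := hw.2
    rw [torusDist_self] at this
    have : 0 < α * n := by positivity
    simp_all [not_lt.2 this.le]
  have h1 : (B.card : ℝ) ≤ A.card + (B \ A).card := by
    exact_mod_cast Nat.sub_le_iff_le_add'.1 (Finset.le_card_sdiff A B)
  have h2 := (Nat.cast_le (α := ℝ)).2 (Finset.card_le_card hsub)
  have hA : (A.card : ℝ) ≤ (2 * α * n + 1) ^ d := by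
    refine (by exact_mod_cast card_torusDist_le v _ :
      (A.card : ℝ) ≤ (2 * ⌊α * n⌋₊ + 1 : ℝ) ^ d).trans (pow_le_pow_left₀ (by positivity) ?_ d)
    linarith [Nat.floor_le (by positivity : 0 ≤ α * n)]
  have hB : (2 * β * n - 1) ^ d ≤ (B.card : ℝ) := by
    -- `β < 1/2` keeps the outer ball from wrapping around the torus.
    have hlt : 2 * ⌊β * n⌋₊ < n := by
      have : (⌊β * n⌋₊ : ℝ) ≤ β * n := Nat.floor_le (by positivity)
      have : (2 * ⌊β * n⌋₊ : ℝ) < n := by nlinarith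
      exact_mod_cast this
    refine (pow_le_pow_left₀ (by linarith) ?_ d).trans
      (by exact_mod_cast le_card_torusDist_le v hlt :
        ((2 * ⌊β * n⌋₊ + 1 : ℝ)) ^ d ≤ (B.card : ℝ))
    linarith [Nat.lt_floor_add_one (β * n)]
  linarith

end TorusMetric

/-! ### Lattice paths and connectedness -/

section TorusPaths

variable {d n : ℕ}

theorem edist_add_single_le [NeZero n] (u : Torus d n) (i : Fin d) (k : ℕ) :
    (torusGraph d n).edist u (u + Pi.single i (k : ZMod n)) ≤ k := by
  induction k with
  | zero => simp
  | succ k ih =>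
    refine (SimpleGraph.edist_triangle
      (v := u + Pi.single i (k : ZMod n))).trans ?_
    push_cast
    refine add_le_add ih (SimpleGraph.edist_le_one_iff_adj_or_eq.2 ?_)
    rw [or_iff_not_imp_right]
    intro hne
    refine (SimpleGraph.fromRel_adj _ _ _).2 ⟨hne, Or.inl ⟨i, ?_, fun j hj => ?_⟩⟩
    · simp [add_assoc]
    · simp [hj]

theorem edist_update_le [NeZero n] (u : Torus d n) (i : Fin d) (a : ZMod n) {t : ℕ}
    (h1 : a.val ≤ (u i).val + t) (h2 : (u i).val ≤ a.val + t) :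
    (torusGraph d n).edist u (Function.update u i a) ≤ t := by
  rcases le_total (u i).val a.val with h | h
  · have hu : Function.update u i a = u + Pi.single i ((a.val - (u i).val : ℕ) : ZMod n) := by
      ext j
      by_cases hj : j = i
      · subst hj; simp [Nat.cast_sub h]
      · simp [hj]
    rw [hu]
    exact (edist_add_single_le u i _).trans (by exact_mod_cast by omega)
  · have hu : u = Function.update u i a + Pi.single i (((u i).val - a.val : ℕ) : ZMod n) := by
      ext j
      by_cases hj : j = i
      · subst hj; simp [Nat.cast_sub h]
      · simp [hj]
    rw [SimpleGraph.edist_comm]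
    nth_rw 2 [hu]
    exact (edist_add_single_le _ i _).trans (by exact_mod_cast by omega)

/-- The coordinates are changed one at a time, each at cost at most `t`, without wrapping around. -/
theorem edist_torusGraph_le [NeZero n] {u v : Torus d n} {t : ℕ}
    (h1 : ∀ i, (v i).val ≤ (u i).val + t) (h2 : ∀ i, (u i).val ≤ (v i).val + t) :
    (torusGraph d n).edist u v ≤ (d * t : ℕ) := by
  classical
  have key : ∀ S : Finset (Fin d), (torusGraph d n).edist u (S.piecewise v u) ≤
      (S.card * t : ℕ) := by
    intro S
    induction S using Finset.induction_on with
    | empty => simp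
    | insert i S hi ih =>
      refine (SimpleGraph.edist_triangle (v := S.piecewise v u)).trans ?_
      rw [Finset.piecewise_insert, Finset.card_insert_of_notMem hi, add_mul, one_mul,
        Nat.cast_add]
      refine add_le_add ih (edist_update_le _ i _ ?_ ?_)
      · simpa [hi] using h1 i
      · simpa [hi] using h2 i
  simpa using key Finset.univ

theorem connected_addLongEdges [NeZero n] (L : Set (Sym2 (Torus d n))) :
    (addLongEdges L).Connected := by
  refine SimpleGraph.Connected.mono le_sup_left ?_
  refine (SimpleGraph.connected_iff _).2 ⟨fun u v => ?_, inferInstance⟩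
  refine SimpleGraph.reachable_of_edist_ne_top (ne_top_of_le_ne_top (ENat.natCast_ne_top _)
    (edist_torusGraph_le (t := n) (fun i => ?_) fun i => ?_))
  · have := (v i).val_lt; omega
  · have := (u i).val_lt; omega

theorem dist_le_diam_addLongEdges [NeZero n] (L : Set (Sym2 (Torus d n))) (u v : Torus d n) :
    (addLongEdges L).dist u v ≤ (addLongEdges L).diam :=
  SimpleGraph.dist_le_diam (SimpleGraph.connected_iff_ediam_ne_top.1 (connected_addLongEdges L))

end TorusPaths

/-! ### Untouched balls and the lower bound for fixed `n` -/

section LowerBound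

variable {d n : ℕ}

/-- A walk too short to leave the ball can take no long edge, and a lattice step changes the
distance to `c` by at most one. -/
theorem torusDist_le_add_length [NeZero n] {L : Set (Sym2 (Torus d n))} {c : Torus d n} {r : ℕ}
    (hL : ∀ e ∈ L, ∀ u ∈ e, r < torusDist c u) {x y : Torus d n}
    (p : (addLongEdges L).Walk x y) (hp : torusDist c x + p.length ≤ r) :
    torusDist c y ≤ torusDist c x + p.length := by
  induction p with
  | nil => simp
  | @cons x z y h p ih =>
    rw [SimpleGraph.Walk.length_cons] at hp ⊢
    have hz : torusDist c z ≤ torusDist c x + 1 := by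
      rcases (SimpleGraph.sup_adj _ _ _ _).1 h with h | h
      · exact (torusDist_triangle c x z).trans (by gcongr; exact torusDist_le_one_of_adj h)
      · have := hL _ ((SimpleGraph.fromEdgeSet_adj _).1 h).1 x (Sym2.mem_mk_left x z)
        omega
    exact (ih (by omega)).trans (by omega)

/-- If no long edge touches some torus ball of radius `r`, then the diameter exceeds `r`. -/
theorem lt_diam_of_untouched_ball [NeZero n] (hd : 1 ≤ d) {L : Set (Sym2 (Torus d n))}
    {c : Torus d n} {r : ℕ} (hr : 2 * (r + 1) < n)
    (hL : ∀ e ∈ L, ∀ u ∈ e, r < torusDist c u) : r < (addLongEdges L).diam := by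
  set y : Torus d n := fun i => c i - (((r + 1 : ℕ) : ℤ) : ZMod n)
  have hy : r < torusDist c y := by
    have h := natAbs_valMinAbs_sub_le_torusDist c y ⟨0, hd⟩
    rw [show c ⟨0, hd⟩ - y ⟨0, hd⟩ = (((r + 1 : ℕ) : ℤ) : ZMod n) from sub_sub_cancel _ _,
      valMinAbs_intCast_eq (by omega)] at h
    omega
  refine lt_of_lt_of_le ?_ (dist_le_diam_addLongEdges L c y)
  by_contra! hle
  obtain ⟨p, hp⟩ := (connected_addLongEdges L).exists_walk_length_eq_dist c y
  have := torusDist_le_add_length hL p (by rw [torusDist_self]; omega)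
  rw [torusDist_self] at this
  omega

open Classical in
/-- The eligible edges with an endpoint in the torus ball of radius `r` around `c`. -/
noncomputable def ballEdges [NeZero n] (α β : ℝ) (c : Torus d n) (r : ℕ) :
    Finset (Sym2 (Torus d n)) :=
  Finset.univ.filter fun e => e ∈ (longPairs d n α β).edgeSet ∧ ∃ u ∈ e, torusDist c u ≤ r

theorem mem_ballEdges [NeZero n] {α β : ℝ} {c : Torus d n} {r : ℕ} {e : Sym2 (Torus d n)} :
    e ∈ ballEdges α β c r ↔
      e ∈ (longPairs d n α β).edgeSet ∧ ∃ u ∈ e, torusDist c u ≤ r := by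
  simp [ballEdges]

theorem card_torus [NeZero n] : Fintype.card (Torus d n) = n ^ d := by
  simp [ZMod.card]

theorem card_ballEdges_le [NeZero n] (α β : ℝ) (c : Torus d n) (r : ℕ) :
    (ballEdges α β c r).card ≤ (2 * r + 1) ^ d * n ^ d := by
  classical
  have hsub : ballEdges α β c r ⊆
      (((Finset.univ.filter fun w => torusDist c w ≤ r) ×ˢ
        (Finset.univ : Finset (Torus d n))).image fun q => s(q.1, q.2)) := by
    intro e he
    obtain ⟨-, u, hu, hcu⟩ := mem_ballEdges.1 he
    obtain ⟨v, rfl⟩ := Sym2.mem_iff_exists.1 hu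
    exact Finset.mem_image.2 ⟨(u, v), by simp [hcu], rfl⟩
  refine (Finset.card_le_card hsub).trans (Finset.card_image_le.trans ?_)
  rw [Finset.card_product, Finset.card_univ, card_torus]
  exact Nat.mul_le_mul_right _ (card_torusDist_le c r)

/-- A common edge would have one end in each of two disjoint balls, and would then be shorter than
`α n`. -/
theorem disjoint_ballEdges [NeZero n] {α β : ℝ} {c c' : Torus d n} {r : ℕ}
    (h1 : 2 * r < torusDist c c') (h2 : (torusDist c c' + 2 * r : ℝ) < α * n) :
    Disjoint (ballEdges α β c r) (ballEdges α β c' r) := by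
  rw [Finset.disjoint_left]
  intro e he he'
  obtain ⟨hE, u, hu, hcu⟩ := mem_ballEdges.1 he
  obtain ⟨-, v, hv, hcv⟩ := mem_ballEdges.1 he'
  rw [torusDist_comm] at hcv
  have huv : u ≠ v := by
    rintro rfl
    have := torusDist_triangle c u c'
    omega
  rw [(Sym2.mem_and_mem_iff huv).1 ⟨hu, hv⟩, SimpleGraph.mem_edgeSet] at hE
  have h3 := torusDist_triangle u c v
  have h4 := torusDist_triangle c c' v
  rw [torusDist_comm u c] at h3
  rw [torusDist_comm c' v] at h4
  have h5 : (torusDist u v : ℝ) ≤ torusDist c c' + 2 * r := by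
    exact_mod_cast (by omega : torusDist u v ≤ torusDist c c' + 2 * r)
  linarith [hE.2.1]

/-- Sites on the diagonal of the torus at mutual distances that are multiples of `s`. -/
def diagonalSite (d n s j : ℕ) : Torus d n := fun _ => ((j * s : ℕ) : ZMod n)

theorem torusDist_diagonalSite [NeZero n] (hd : 1 ≤ d) {s m j k : ℕ} (hm : 2 * (m * s) < n)
    (hj : j < m) (hk : k < m) :
    torusDist (diagonalSite d n s j) (diagonalSite d n s k) =
      ((j : ℤ) * s - k * s).natAbs := by
  have hjs : j * s ≤ m * s := Nat.mul_le_mul_right _ hj.le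
  have hks : k * s ≤ m * s := Nat.mul_le_mul_right _ hk.le
  have h : ((((j * s : ℕ) : ZMod n) - ((k * s : ℕ) : ZMod n))).valMinAbs =
      (j : ℤ) * s - k * s := by
    have := valMinAbs_intCast_eq (n := n) (k := ((j * s : ℕ) : ℤ) - (k * s : ℕ)) (by omega)
    push_cast at this ⊢
    exact this
  refine le_antisymm (torusDist_le_iff.2 fun i => ?_) ?_
  · simp only [diagonalSite]
    rw [h]
  · have := natAbs_valMinAbs_sub_le_torusDist (diagonalSite d n s j) (diagonalSite d n s k)
      ⟨0, hd⟩
    simp only [diagonalSite] at this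
    rwa [h] at this

theorem one_sub_le_prob_lt_diam [NeZero n] (hd : 1 ≤ d) {α β : ℝ} (σ ζ : ℝ) {r m : ℕ}
    (hm0 : 1 ≤ m) (hm : 2 * ((m + 1) * (2 * r + 1)) < n)
    (hmα : ((m + 1) * (2 * r + 1) : ℝ) < α * n) :
    1 - (1 - (1 - (longProb d n σ ζ : ℝ)) ^ ((2 * r + 1) ^ d * n ^ d)) ^ m ≤
      (longEdgeLaw d n α β σ ζ).real {L | r < (addLongEdges L).diam} := by
  have hms : 2 * (m * (2 * r + 1)) < n := by nlinarith
  -- Spacing `2 r + 1` makes the balls disjoint, while `hmα` keeps all of them within eligible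
  -- length of each other.
  set S : Fin m → Finset (Sym2 (Torus d n)) := fun j =>
    ballEdges α β (diagonalSite d n (2 * r + 1) j) r
  have hS : Pairwise fun i j => Disjoint (S i) (S j) := by
    intro i j hij
    have hdist := torusDist_diagonalSite hd hms i.2 j.2
    have hij' : (i : ℕ) ≠ j := fun h => hij (Fin.ext h)
    have hfac : ((i : ℕ) : ℤ) * (2 * r + 1 : ℕ) - (j : ℕ) * (2 * r + 1 : ℕ) =
      ((i : ℕ) - (j : ℕ) : ℤ) * (2 * r + 1 : ℕ) := by ring
    rw [hfac, Int.natAbs_mul, Int.natAbs_natCast] at hdist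
    have hlo : 1 ≤ ((i : ℕ) - (j : ℕ) : ℤ).natAbs := by omega
    have hhi : ((i : ℕ) - (j : ℕ) : ℤ).natAbs ≤ m := by omega
    refine disjoint_ballEdges ?_ ?_
    · rw [hdist]; nlinarith
    · refine lt_of_le_of_lt ?_ hmα
      rw [hdist]
      have : ((i : ℕ) - (j : ℕ) : ℤ).natAbs * (2 * r + 1) + 2 * r ≤ (m + 1) * (2 * r + 1) := by
        nlinarith
      exact_mod_cast this
  have hhit := setBernoulli_real_hit_all_le (longPairs d n α β).edgeSet (longProb d n σ ζ) S hS
    ((2 * r + 1) ^ d * n ^ d) (fun i e he => (mem_ballEdges.1 he).1)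
    (fun i => card_ballEdges_le α β _ r)
  rw [Fintype.card_fin] at hhit
  set μ := setBernoulli (longPairs d n α β).edgeSet (longProb d n σ ζ) with hμ
  have hle : μ.real {L | ∀ i, ∃ e ∈ S i, e ∈ L}ᶜ ≤
      μ.real {L | r < (addLongEdges L).diam} := by
    -- Almost surely all long edges are eligible, so missing the eligible edges at a ball means
    -- missing the ball.
    refine ENNReal.toReal_mono (measure_ne_top _ _) (measure_mono_ae ?_)
    filter_upwards [setBernoulli_ae_subset (u := (longPairs d n α β).edgeSet)
      (p := longProb d n σ ζ)] with L hLE hL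
    change ¬ ∀ i, ∃ e ∈ S i, e ∈ L at hL
    push Not at hL
    obtain ⟨i, hi⟩ := hL
    refine lt_diam_of_untouched_ball hd (c := diagonalSite d n (2 * r + 1) i) (by nlinarith) ?_
    intro e he u hu
    by_contra! hcu
    exact hi e (mem_ballEdges.2 ⟨hLE he, u, hu, hcu⟩) he
  rw [probReal_compl_eq_one_sub (Set.toFinite _).measurableSet] at hle
  change _ ≤ μ.real _
  linarith

/-- For `x ≤ 1/2`, `1 / (1 - x) ≤ 1 + 2 x ≤ exp (2 x)`. -/
theorem exp_neg_two_mul_le_one_sub {x : ℝ} (h0 : 0 ≤ x) (h1 : x ≤ 1 / 2) :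
    Real.exp (-(2 * x)) ≤ 1 - x := by
  rw [Real.exp_neg, inv_le_comm₀ (Real.exp_pos _) (by linarith)]
  refine le_trans ?_ (Real.add_one_le_exp _)
  rw [inv_le_iff_one_le_mul₀ (by linarith)]
  nlinarith

theorem longProb_le {d n : ℕ} {σ ζ : ℝ} (hσ : 0 ≤ σ) (hn : 1 ≤ n) :
    (longProb d n σ ζ : ℝ) ≤ σ * Real.log n ^ ζ / (n : ℝ) ^ d := by
  rw [longProb, Set.coe_projIcc]
  have : 0 ≤ Real.log n := Real.log_natCast_nonneg n
  exact max_le (by positivity) (min_le_right _ _)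

end LowerBound

/-! ### Asymptotics of the lower bound -/

section LowerBoundLimit

/-- Auxiliary growth condition: the number of disjoint balls is of order `√n`. -/
theorem eventually_room {α κ : ℝ} (hα : 0 < α) :
    ∀ᶠ n : ℕ in atTop, ((Nat.sqrt n + 1 : ℕ) * (2 * ⌊Real.log n ^ κ⌋₊ + 1 : ℝ)) < α * n := by
  have h1 : (fun x : ℝ => Real.log x ^ κ) =o[atTop] fun x => x ^ (1 / 2 : ℝ) :=
    isLittleO_log_rpow_rpow_atTop κ (by norm_num)
  have h2 : Tendsto (fun n : ℕ => (n : ℝ)) atTop atTop := tendsto_natCast_atTop_atTop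
  -- With `ln^κ n ≤ (α/8) √n` and `1 < (α/4) √n`, the side `2 r + 1` is below `(α/2) √n`; the other
  -- factor is at most `2 √n`.
  have h3 := (h1.comp_tendsto h2).bound (show 0 < α / 8 by positivity)
  have h4 : ∀ᶠ n : ℕ in atTop, 4 / α < Real.sqrt n :=
    (Real.tendsto_sqrt_atTop.comp h2).eventually_gt_atTop _
  filter_upwards [h3, h4, eventually_ge_atTop 1] with n h3 h4 hn
  have hn' : (1 : ℝ) ≤ n := by exact_mod_cast hn
  have hlog : 0 ≤ Real.log n := Real.log_natCast_nonneg n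
  simp only [Function.comp, Real.norm_eq_abs, ← Real.sqrt_eq_rpow] at h3
  rw [abs_of_nonneg (by positivity), abs_of_nonneg (by positivity)] at h3
  have hfl := Nat.floor_le (show 0 ≤ Real.log n ^ κ by positivity)
  have hs1 : 1 ≤ Real.sqrt n := by rw [Real.one_le_sqrt]; exact hn'
  have hss : Real.sqrt n * Real.sqrt n = n := Real.mul_self_sqrt (by positivity)
  have hsq : (Nat.sqrt n : ℝ) ≤ Real.sqrt n := Real.nat_sqrt_le_real_sqrt
  push_cast
  have h5 : 4 < α * Real.sqrt n := by
    rw [div_lt_iff₀ hα] at h4; linarith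
  have h6 : (2 * ⌊Real.log n ^ κ⌋₊ + 1 : ℝ) < α * Real.sqrt n / 2 := by linarith
  calc ((Nat.sqrt n : ℝ) + 1) * (2 * ⌊Real.log n ^ κ⌋₊ + 1)
      ≤ (2 * Real.sqrt n) * (2 * ⌊Real.log n ^ κ⌋₊ + 1) := by gcongr; linarith
    _ < (2 * Real.sqrt n) * (α * Real.sqrt n / 2) := by gcongr
    _ = α * (Real.sqrt n * Real.sqrt n) := by ring
    _ = α * n := by rw [hss]

/-- `hgrowth` bounds the expected number of long edges at a ball by `(ln n)/8`. The probability that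
all `⌊√n⌋` balls are touched is then at most `exp (-n^(1/4) / 2)`. -/
theorem tendsto_probDiam_lower {d : ℕ} (hd : 1 ≤ d) {α : ℝ} (β : ℝ) (hα : 0 < α)
    {σ ζ κ : ℝ} (hσ : 0 < σ) (hκ : 0 < κ)
    (hgrowth : ∀ᶠ n : ℕ in atTop,
      σ * 3 ^ d * Real.log n ^ (κ * d + ζ) ≤ Real.log n / 8) :
    Tendsto (fun n : ℕ => probDiam d n α β σ ζ (fun D => Real.log n ^ κ ≤ (D : ℝ)))
      atTop (𝓝 1) := by
  have hcast : Tendsto (fun n : ℕ => (n : ℝ)) atTop atTop := tendsto_natCast_atTop_atTop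
  have hlow : Tendsto (fun n : ℕ => 1 - Real.exp (-(1 / 2 * (n : ℝ) ^ (1 / 4 : ℝ)))) atTop
      (𝓝 1) := by
    have h1 : Tendsto (fun n : ℕ => (1 / 2 * (n : ℝ) ^ (1 / 4 : ℝ))) atTop atTop :=
      ((tendsto_rpow_atTop (by norm_num)).comp hcast).const_mul_atTop (by norm_num)
    simpa using (Real.tendsto_exp_neg_atTop_nhds_zero.comp h1).const_sub 1
  refine tendsto_of_tendsto_of_tendsto_of_le_of_le' hlow tendsto_const_nhds ?_ ?_
  swap
  · filter_upwards [eventually_ge_atTop 1] with n hn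
    have : NeZero n := ⟨by omega⟩
    exact measureReal_le_one (μ := setBernoulli _ _)
  -- The second use of `eventually_room`, with `1/2` for `α`, prevents the row of balls from
  -- wrapping around.
  filter_upwards [hgrowth, eventually_room (κ := κ) hα,
    eventually_room (κ := κ) (show (0 : ℝ) < 1 / 2 by norm_num), eventually_ge_atTop 1,
    (Real.tendsto_log_atTop.comp hcast).eventually_ge_atTop 1] with n hg hr1 hr2 hn hlog
  have : NeZero n := ⟨by omega⟩
  simp only [Function.comp] at hlog
  set r := ⌊Real.log n ^ κ⌋₊
  set m := Nat.sqrt n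
  set p : ℝ := (longProb d n σ ζ : ℝ)
  have hn' : (1 : ℝ) ≤ n := by exact_mod_cast hn
  have hnd : (0 : ℝ) < (n : ℝ) ^ d := by positivity
  have hp0 : 0 ≤ p := (longProb d n σ ζ).2.1
  have hp1 : p ≤ 1 := (longProb d n σ ζ).2.2
  have hlog0 : 0 < Real.log n := by linarith
  have hκ1 : 1 ≤ Real.log n ^ κ := Real.one_le_rpow hlog hκ.le
  have hrκ : (r : ℝ) ≤ Real.log n ^ κ := Nat.floor_le (by positivity)
  have hK : p * ((2 * r + 1) ^ d * n ^ d : ℕ) ≤ Real.log n / 8 := by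
    refine le_trans ?_ hg
    have h1 : ((2 * r + 1 : ℝ)) ^ d ≤ 3 ^ d * Real.log n ^ (κ * d) := by
      rw [Real.rpow_mul hlog0.le, Real.rpow_natCast, ← mul_pow]
      gcongr
      linarith
    have h2 : p * (n : ℝ) ^ d ≤ σ * Real.log n ^ ζ := by
      rw [← le_div_iff₀ hnd]; exact longProb_le hσ.le hn
    push_cast
    calc p * ((2 * r + 1 : ℝ) ^ d * (n : ℝ) ^ d) = (2 * r + 1 : ℝ) ^ d * (p * (n : ℝ) ^ d) := by
          ring
      _ ≤ (3 ^ d * Real.log n ^ (κ * d)) * (σ * Real.log n ^ ζ) := by gcongr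
      _ = σ * 3 ^ d * Real.log n ^ (κ * d + ζ) := by rw [Real.rpow_add hlog0]; ring
  have hp2 : p ≤ 1 / 2 := by
    have h1 : p * n ≤ p * ((2 * r + 1) ^ d * n ^ d : ℕ) := by
      gcongr
      exact (Nat.le_self_pow (by omega) n).trans (Nat.le_mul_of_pos_left _ (by positivity))
    have h2 : Real.log n ≤ n := (Real.log_le_sub_one_of_pos (by linarith)).trans (by linarith)
    nlinarith
  set K := (2 * r + 1) ^ d * n ^ d
  have hpow : (n : ℝ) ^ (-(1 / 4) : ℝ) ≤ (1 - p) ^ K := by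
    rw [Real.rpow_def_of_pos (by linarith)]
    calc Real.exp (Real.log n * -(1 / 4)) ≤ Real.exp (K * (-(2 * p))) := by
          apply Real.exp_le_exp.2; linarith
      _ = Real.exp (-(2 * p)) ^ K := Real.exp_nat_mul _ _
      _ ≤ (1 - p) ^ K := by
          gcongr
          exact exp_neg_two_mul_le_one_sub hp0 hp2
  have hm0 : 1 ≤ m := Nat.sqrt_pos.2 hn
  have hmhalf : Real.sqrt n / 2 ≤ m := by
    have h1 := Real.real_sqrt_lt_nat_sqrt_succ (a := n)
    have h2 : (1 : ℝ) ≤ m := by exact_mod_cast hm0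
    linarith
  have hmain : (1 - (1 - p) ^ K) ^ m ≤ Real.exp (-(1 / 2 * (n : ℝ) ^ (1 / 4 : ℝ))) := by
    have h1 : (1 - (1 - p) ^ K) ≤ Real.exp (-(n : ℝ) ^ (-(1 / 4) : ℝ)) :=
      le_trans (by linarith) (Real.one_sub_le_exp_neg _)
    have h0 : 0 ≤ 1 - (1 - p) ^ K := by
      have := pow_le_one₀ (n := K) (by linarith : 0 ≤ 1 - p) (by linarith)
      linarith
    refine (pow_le_pow_left₀ h0 h1 m).trans ?_
    rw [← Real.exp_nat_mul]
    apply Real.exp_le_exp.2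
    have h2 : (n : ℝ) ^ (1 / 4 : ℝ) = Real.sqrt n * (n : ℝ) ^ (-(1 / 4) : ℝ) := by
      rw [Real.sqrt_eq_rpow, ← Real.rpow_add (by linarith)]
      norm_num
    rw [h2]
    have h3 : 0 ≤ (n : ℝ) ^ (-(1 / 4) : ℝ) := by positivity
    nlinarith
  have hprob := one_sub_le_prob_lt_diam (β := β) hd σ ζ hm0
    (by
      have : ((2 * ((m + 1) * (2 * r + 1)) : ℕ) : ℝ) < n := by push_cast at hr2 ⊢; linarith
      exact_mod_cast this) (by push_cast at hr1; exact hr1)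
  refine (by linarith : _ ≤ 1 - (1 - (1 - p) ^ K) ^ m).trans (hprob.trans ?_)
  refine measureReal_mono (μ := setBernoulli _ _) ?_
  intro L hL
  have h1 : (r + 1 : ℝ) ≤ (addLongEdges L).diam := by exact_mod_cast hL
  -- The strict bound `r < diam` makes up for the floor in `r`.
  exact (Nat.lt_floor_add_one _).le.trans h1

end LowerBoundLimit

/-! ### Block expansion and distances -/

section BlockExpansion

variable {V I : Type*} [Fintype V]

open Classical in
/-- The number of sites in the union of the blocks in `A`, where `b` assigns its block to each
site. -/
noncomputable def blockVolume (b : V → I) (A : Finset I) : ℕ :=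
  (Finset.univ.filter fun v => b v ∈ A).card

/-- Every block family that covers at most half of the sites sends an edge of `L` out of each
family that contains it and is larger by a factor of at most `1 + c`. -/
def IsBlockExpanding (b : V → I) (c : ℝ) (L : Set (Sym2 V)) : Prop :=
  ∀ A W : Finset I, A.Nonempty → A ⊆ W → 2 * blockVolume b A ≤ Fintype.card V →
    (W.card : ℝ) ≤ (1 + c) * A.card → ∃ u w, b u ∈ A ∧ b w ∉ W ∧ s(u, w) ∈ L

theorem blockVolume_eq_sum [DecidableEq I] (b : V → I) (A : Finset I) :
    blockVolume b A = ∑ i ∈ A, (Finset.univ.filter fun v => b v = i).card := by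
  classical
  rw [blockVolume, Finset.card_eq_sum_card_fiberwise (t := A) (f := b) (by intro v; simp)]
  refine Finset.sum_congr rfl fun i hi => ?_
  congr 1
  ext v
  simp only [Finset.mem_filter, Finset.mem_univ, true_and]
  constructor
  · exact fun h => h.2
  · rintro rfl; exact ⟨hi, rfl⟩

theorem blockVolume_mono (b : V → I) {A W : Finset I} (h : A ⊆ W) :
    blockVolume b A ≤ blockVolume b W :=
  Finset.card_le_card fun v => by simpa using fun hv => h hv

section Diameter

variable [Fintype I]

open Classical in
/-- The blocks all of whose sites are within `D + j (D + 1)` of `v`. -/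
noncomputable def reachedBlocks (G : SimpleGraph V) (b : V → I) (D : ℕ) (v : V) (j : ℕ) :
    Finset I :=
  Finset.univ.filter fun i => ∀ w, b w = i → G.edist v w ≤ (D + j * (D + 1) : ℕ)

theorem mem_reachedBlocks {G : SimpleGraph V} {b : V → I} {D : ℕ} {v : V} {j : ℕ} {i : I} :
    i ∈ reachedBlocks G b D v j ↔ ∀ w, b w = i → G.edist v w ≤ (D + j * (D + 1) : ℕ) := by
  simp [reachedBlocks]

theorem reachedBlocks_mono (G : SimpleGraph V) (b : V → I) (D : ℕ) (v : V) :
    Monotone (reachedBlocks G b D v) := by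
  intro j k hjk i hi
  rw [mem_reachedBlocks] at hi ⊢
  intro w hw
  refine (hi w hw).trans ?_
  exact_mod_cast Nat.add_le_add_left (Nat.mul_le_mul_right _ hjk) _

/-- While at most half of the sites are covered, each round multiplies the number of reached blocks
by more than `1 + c`; after `J` rounds this would exceed the number of blocks. A round costs `D +
1`: one long edge, then at most `D` to fill the new block. -/
theorem half_lt_blockVolume_reachedBlocks {G : SimpleGraph V} {b : V → I} {D J : ℕ} {c : ℝ}
    {L : Set (Sym2 V)} (hblock : ∀ u w, b u = b w → G.edist u w ≤ D)
    (hlong : ∀ u w, s(u, w) ∈ L → G.edist u w ≤ 1) (hL : IsBlockExpanding b c L) (hc : 0 ≤ c)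
    (hJ : (Fintype.card I : ℝ) < (1 + c) ^ J) (v : V) :
    Fintype.card V < 2 * blockVolume b (reachedBlocks G b D v J) := by
  by_contra! hle
  have hgrow : ∀ j ≤ J, (1 + c) ^ j ≤ (reachedBlocks G b D v j).card := by
    intro j
    induction j with
    | zero =>
      intro _
      have h0 : (reachedBlocks G b D v 0).Nonempty :=
        ⟨b v, mem_reachedBlocks.2 fun w hw => by simpa using hblock v w hw.symm⟩
      simpa using h0.card_pos
    | succ j ih =>
      intro hj
      have ih := ih (by omega)
      by_contra! hlt
      have hpos : 0 < (reachedBlocks G b D v j).card := by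
        have : (0 : ℝ) < (reachedBlocks G b D v j).card := lt_of_lt_of_le (by positivity) ih
        exact_mod_cast this
      -- Taking `W` to be the next stage, too little growth yields an edge into a block outside it,
      -- yet that edge puts the block into the next stage.
      obtain ⟨u, w, hu, hw, huw⟩ := hL _ (reachedBlocks G b D v (j + 1))
        (Finset.card_pos.1 hpos) (reachedBlocks_mono G b D v (Nat.le_succ j))
        (le_trans (Nat.mul_le_mul_left 2
          (blockVolume_mono b (reachedBlocks_mono G b D v (by omega : j ≤ J)))) hle)
        (hlt.le.trans (by rw [pow_succ']; gcongr))
      refine hw (mem_reachedBlocks.2 fun w' hw' => ?_)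
      calc G.edist v w' ≤ G.edist v u + G.edist u w + G.edist w w' :=
            SimpleGraph.edist_triangle.trans (by gcongr; exact SimpleGraph.edist_triangle)
        _ ≤ (D + j * (D + 1) : ℕ) + 1 + D := by
            gcongr
            · exact mem_reachedBlocks.1 hu u rfl
            · exact hlong u w huw
            · exact hblock w w' hw'.symm
        _ ≤ (D + (j + 1) * (D + 1) : ℕ) := by
            norm_cast
            exact le_of_eq (by ring)
  have h1 := hgrow J le_rfl
  have h2 : ((reachedBlocks G b D v J).card : ℝ) ≤ Fintype.card I := by
    exact_mod_cast Finset.card_le_univ _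
  linarith

/-- Block expansion turns into a bound for all distances. -/
theorem edist_le_of_isBlockExpanding {G : SimpleGraph V} {b : V → I} {D J : ℕ} {c : ℝ}
    {L : Set (Sym2 V)} (hblock : ∀ u w, b u = b w → G.edist u w ≤ D)
    (hlong : ∀ u w, s(u, w) ∈ L → G.edist u w ≤ 1) (hL : IsBlockExpanding b c L) (hc : 0 ≤ c)
    (hJ : (Fintype.card I : ℝ) < (1 + c) ^ J) (v v' : V) :
    G.edist v v' ≤ (2 * (D + J * (D + 1)) : ℕ) := by
  classical
  have h := half_lt_blockVolume_reachedBlocks hblock hlong hL hc hJ v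
  have h' := half_lt_blockVolume_reachedBlocks hblock hlong hL hc hJ v'
  obtain ⟨w, hw⟩ : ((Finset.univ.filter fun w => b w ∈ reachedBlocks G b D v J) ∩
      (Finset.univ.filter fun w => b w ∈ reachedBlocks G b D v' J)).Nonempty := by
    -- Both sets contain more than half of the sites.
    refine Finset.inter_nonempty_of_card_lt_card_add_card (Finset.subset_univ _)
      (Finset.subset_univ _) ?_
    rw [Finset.card_univ]
    unfold blockVolume at h h'
    omega
  simp only [Finset.mem_inter, Finset.mem_filter, Finset.mem_univ, true_and] at hw
  refine (SimpleGraph.edist_triangle (v := w)).trans ?_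
  rw [two_mul, Nat.cast_add]
  refine add_le_add (mem_reachedBlocks.1 hw.1 w rfl) ?_
  rw [SimpleGraph.edist_comm]
  exact mem_reachedBlocks.1 hw.2 w rfl

end Diameter

/-! ### Union bound for block expansion -/

section Probability

open Classical in
/-- The eligible edges that lead from a block in `A` to a block outside of `W`. -/
noncomputable def crossingEdges (E : SimpleGraph V) (b : V → I) (A W : Finset I) :
    Finset (Sym2 V) :=
  (Finset.univ.filter fun q : V × V => b q.1 ∈ A ∧ b q.2 ∉ W ∧ E.Adj q.1 q.2).image
    fun q => s(q.1, q.2)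

-- At most `blockVolume b W` of the partners of a site of `A` lie in `W`. No edge is counted twice:
-- as `A ⊆ W`, only one of its ends can lie in `A`.
open Classical in
theorem mul_le_card_crossingEdges (E : SimpleGraph V) (b : V → I) {A W : Finset I} (hAW : A ⊆ W)
    {k : ℝ} (hdeg : ∀ v, k ≤ (Finset.univ.filter fun w => E.Adj v w).card) :
    blockVolume b A * (k - blockVolume b W) ≤ (crossingEdges E b A W).card := by
  have hcard : (crossingEdges E b A W).card =
      ∑ u ∈ Finset.univ.filter fun u => b u ∈ A,
        (Finset.univ.filter fun w => b w ∉ W ∧ E.Adj u w).card := by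
    rw [crossingEdges, Finset.card_image_of_injOn, ← Finset.card_sigma]
    · refine Finset.card_nbij' (fun q => ⟨q.1, q.2⟩) (fun q => (q.1, q.2)) ?_ ?_ ?_ ?_ <;>
        intro q <;> simp
    · rintro ⟨u, w⟩ h ⟨u', w'⟩ h' heq
      simp only [Finset.coe_filter, Finset.mem_univ, true_and, Set.mem_ofPred_eq] at h h'
      rcases Sym2.eq_iff.1 heq with ⟨rfl, rfl⟩ | ⟨rfl, rfl⟩
      · rfl
      · exact absurd (hAW h.1) h'.2.1
  rw [hcard, Nat.cast_sum, blockVolume, ← nsmul_eq_mul]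
  refine Finset.card_nsmul_le_sum _ _ _ fun u _ => ?_
  have h1 : (Finset.univ.filter fun w => E.Adj u w) ⊆
      (Finset.univ.filter fun w => b w ∉ W ∧ E.Adj u w) ∪
        (Finset.univ.filter fun w => b w ∈ W) := by
    intro w
    simp only [Finset.mem_filter, Finset.mem_univ, true_and, Finset.mem_union]
    tauto
  have h2 := (Finset.card_le_card h1).trans (Finset.card_union_le _ _)
  have h3 : ((Finset.univ.filter fun w => E.Adj u w).card : ℝ) ≤
      (Finset.univ.filter fun w => b w ∉ W ∧ E.Adj u w).card + blockVolume b W := by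
    exact_mod_cast h2
  linarith [hdeg u]

/-- The sum over all subsets of `I` of `x ^ |A|` is at most `exp (x |I|)`. -/
theorem sum_pow_card_le_exp [Fintype I] {x : ℝ} (hx : 0 ≤ x) :
    ∑ A : Finset I, x ^ A.card ≤ Real.exp (x * Fintype.card I) := by
  have h : ∑ A : Finset I, x ^ A.card = (x + 1) ^ Fintype.card I := by
    simpa using Fintype.sum_pow_mul_eq_add_pow I x 1
  rw [h, mul_comm, Real.exp_nat_mul]
  gcongr
  exact Real.add_one_le_exp x

open Classical in
/-- Block expansion fails with a probability that is small in the number of sites, once the blocks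
are of at least logarithmic size. -/
theorem prob_not_isBlockExpanding_le [Fintype I] (E : SimpleGraph V) (b : V → I)
    (p : unitInterval) {c γ δ K m : ℝ} (hc0 : 0 ≤ c) (hc1 : c ≤ 1) (hK : 0 ≤ K)
    (hδ : 0 ≤ δ) (hγ : 1 / 2 + c * K / 2 + δ ≤ γ) (hm : 0 ≤ m)
    (hlo : ∀ i, m ≤ (Finset.univ.filter fun v => b v = i).card)
    (hhi : ∀ i, ((Finset.univ.filter fun v => b v = i).card : ℝ) ≤ K * m)
    (hdeg : ∀ v, γ * Fintype.card V ≤ (Finset.univ.filter fun w => E.Adj v w).card)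
    (hV : 1 ≤ Fintype.card V) (hI : Fintype.card I ≤ Fintype.card V)
    (hp : 4 * Real.log (Fintype.card V) ≤ p * (m * (δ * Fintype.card V))) :
    (setBernoulli E.edgeSet p).real {L | ¬ IsBlockExpanding b c L} ≤
      Real.exp 2 / Fintype.card V := by
  set N : ℝ := (Fintype.card V : ℝ)
  have hN1 : (1 : ℝ) ≤ N := Nat.one_le_cast.2 hV
  have hN0 : 0 < N := by linarith
  set μ := setBernoulli E.edgeSet p
  set admissible : Finset (Finset I × Finset I) := Finset.univ.filter fun q =>
    q.1.Nonempty ∧ q.1 ⊆ q.2 ∧ 2 * blockVolume b q.1 ≤ Fintype.card V ∧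
      (q.2.card : ℝ) ≤ (1 + c) * q.1.card
  have hcover : {L | ¬ IsBlockExpanding b c L} ⊆
      ⋃ q ∈ admissible, {L | ∀ e ∈ crossingEdges E b q.1 q.2, e ∉ L} := by
    intro L hL
    simp only [Set.mem_ofPred_eq, IsBlockExpanding] at hL
    push Not at hL
    obtain ⟨A, W, hA, hAW, hvol, hcard, hno⟩ := hL
    refine Set.mem_biUnion (x := (A, W)) (by simp [admissible, hA, hAW, hvol, hcard]) ?_
    intro e he
    obtain ⟨⟨u, w⟩, hq, rfl⟩ := Finset.mem_image.1 he
    simp only [Finset.mem_filter, Finset.mem_univ, true_and] at hq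
    exact hno u w hq.1 hq.2.1
  have hterm : ∀ q ∈ admissible, μ.real {L | ∀ e ∈ crossingEdges E b q.1 q.2, e ∉ L} ≤
      N⁻¹ * (N⁻¹ ^ q.1.card * N⁻¹ ^ q.2.card) := by
    rintro ⟨A, W⟩ hq
    simp only [admissible, Finset.mem_filter, Finset.mem_univ, true_and] at hq ⊢
    obtain ⟨hA, hAW, hvol, hcard⟩ := hq
    have hsum : ∀ B : Finset I, (blockVolume b B : ℝ) =
        ∑ i ∈ B, ((Finset.univ.filter fun v => b v = i).card : ℝ) := by
      intro B; rw [blockVolume_eq_sum]; push_cast; rfl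
    have hvolA : A.card * m ≤ blockVolume b A := by
      rw [hsum, ← nsmul_eq_mul]
      exact Finset.card_nsmul_le_sum _ _ _ fun i _ => hlo i
    have hvolA' : 2 * (blockVolume b A : ℝ) ≤ N := by
      simp only [N]
      exact_mod_cast hvol
    have hdiff : ((W \ A).card : ℝ) ≤ c * A.card := by
      rw [Finset.cast_card_sdiff hAW]; linarith
    -- The blocks added in `W` number at most `c |A|`, and comparable block sizes turn this into a
    -- bound on volume.
    have hvolW : (blockVolume b W : ℝ) ≤ blockVolume b A + c * K * blockVolume b A := by
      rw [hsum W, ← Finset.sum_sdiff hAW, ← hsum A, add_comm]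
      gcongr
      calc _ ≤ ((W \ A).card : ℝ) * (K * m) := by
            rw [← nsmul_eq_mul]
            exact Finset.sum_le_card_nsmul _ _ _ fun i _ => hhi i
        _ ≤ (c * A.card) * (K * m) := by gcongr
        _ = c * K * (A.card * m) := by ring
        _ ≤ c * K * blockVolume b A := by gcongr
    have hcross : A.card * (m * (δ * N)) ≤ ((crossingEdges E b A W).card : ℝ) := by
      refine le_trans ?_ (mul_le_card_crossingEdges E b hAW hdeg)
      rw [← mul_assoc]
      have hcK : c * K * (2 * blockVolume b A) ≤ c * K * N := by gcongr
      gcongr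
      nlinarith
    have hsub : ∀ e ∈ crossingEdges E b A W, e ∈ E.edgeSet := by
      intro e he
      obtain ⟨⟨u, w⟩, hq, rfl⟩ := Finset.mem_image.1 he
      simp only [Finset.mem_filter, Finset.mem_univ, true_and] at hq
      exact hq.2.2
    rw [setBernoulli_real_avoid_of_subset _ _ _ hsub]
    have hp0 : 0 ≤ (p : ℝ) := p.2.1
    have hA1 : 1 ≤ A.card := hA.card_pos
    have hW2 : W.card ≤ 2 * A.card := by
      have : (W.card : ℝ) ≤ 2 * A.card := hcard.trans (by gcongr; linarith)
      exact_mod_cast this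
    calc (1 - (p : ℝ)) ^ (crossingEdges E b A W).card
        ≤ Real.exp (-p) ^ (crossingEdges E b A W).card :=
          pow_le_pow_left₀ (sub_nonneg.2 p.2.2) (Real.one_sub_le_exp_neg _) _
      _ = Real.exp (-(p * (crossingEdges E b A W).card)) := by
          rw [← Real.exp_nat_mul]; ring_nf
      -- Since `|W| ≤ 2 |A|` and `1 ≤ |A|`, the exponent `4 |A|` pays for `A`, for `W` and for one
      -- spare factor `1/N`.
      _ ≤ Real.exp (-(4 * A.card * Real.log N)) := by
          refine Real.exp_le_exp.2 (neg_le_neg ?_)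
          calc 4 * (A.card : ℝ) * Real.log N = A.card * (4 * Real.log N) := by ring
            _ ≤ A.card * (p * (m * (δ * N))) := by gcongr
            _ = p * (A.card * (m * (δ * N))) := by ring
            _ ≤ _ := by gcongr
      _ = N⁻¹ ^ (4 * A.card) := by
          rw [inv_pow, ← Real.exp_log hN0, ← Real.exp_nat_mul, ← Real.exp_neg,
            Real.log_exp]
          push_cast
          ring_nf
      _ ≤ N⁻¹ ^ (1 + (A.card + W.card)) :=
          pow_le_pow_of_le_one (by positivity) (inv_le_one_of_one_le₀ hN1) (by omega)
      _ = _ := by rw [pow_add, pow_one, pow_add]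
  have hexp : ∑ A : Finset I, N⁻¹ ^ A.card ≤ Real.exp 1 := by
    refine (sum_pow_card_le_exp (by positivity)).trans (Real.exp_le_exp.2 ?_)
    rw [inv_mul_le_iff₀ hN0, mul_one]
    exact Nat.cast_le.2 hI
  calc μ.real {L | ¬ IsBlockExpanding b c L}
      ≤ μ.real (⋃ q ∈ admissible, {L | ∀ e ∈ crossingEdges E b q.1 q.2, e ∉ L}) :=
        measureReal_mono hcover (measure_ne_top (setBernoulli _ _) _)
    _ ≤ ∑ q ∈ admissible, μ.real {L | ∀ e ∈ crossingEdges E b q.1 q.2, e ∉ L} :=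
        measureReal_biUnion_finset_le _ _
    _ ≤ ∑ q ∈ admissible, N⁻¹ * (N⁻¹ ^ q.1.card * N⁻¹ ^ q.2.card) := Finset.sum_le_sum hterm
    -- Over all pairs the sum factorizes, each factor being at most `exp 1` because `|I| ≤ N`.
    _ ≤ ∑ q : Finset I × Finset I, N⁻¹ * (N⁻¹ ^ q.1.card * N⁻¹ ^ q.2.card) :=
        Finset.sum_le_sum_of_subset_of_nonneg (Finset.subset_univ _) fun _ _ _ => by positivity
    _ = N⁻¹ * ((∑ A : Finset I, N⁻¹ ^ A.card) * ∑ W : Finset I, N⁻¹ ^ W.card) := by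
        rw [← Finset.mul_sum, Fintype.sum_mul_sum, Fintype.sum_prod_type]
    _ ≤ N⁻¹ * (Real.exp 1 * Real.exp 1) := by gcongr
    _ = Real.exp 2 / N := by
        rw [← Real.exp_add, div_eq_inv_mul]; norm_num

end Probability

end BlockExpansion

/-! ### Partition of the torus into boxes -/

section TorusBlocks

variable {d n : ℕ}

/-- The index of the interval of length `s` that contains `x`, where the last interval also takes
the remainder. -/
def intervalIndex {s q : ℕ} (hq : 0 < q) (x : ZMod n) : Fin q :=
  ⟨min (x.val / s) (q - 1), by omega⟩

/-- The remainder is shorter than `s`, so even the last interval is shorter than `2 s`. -/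
theorem val_mem_of_intervalIndex_eq [NeZero n] {s : ℕ} (hs : 0 < s) (hq : 0 < n / s)
    {x : ZMod n} {j : Fin (n / s)} (h : intervalIndex (s := s) hq x = j) :
    j * s ≤ x.val ∧ x.val < j * s + 2 * s := by
  have hj : min (x.val / s) (n / s - 1) = j := congrArg Fin.val h
  have hx := x.val_lt
  have h1 : x.val < (x.val / s + 1) * s := by
    rw [mul_comm]; exact Nat.lt_mul_div_succ _ hs
  have h2 : x.val / s * s ≤ x.val := Nat.div_mul_le_self _ _
  have h3 : n < (n / s + 1) * s := by
    rw [mul_comm]; exact Nat.lt_mul_div_succ _ hs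
  refine ⟨(Nat.mul_le_mul_right s (hj ▸ min_le_left _ _)).trans h2, ?_⟩
  rcases le_total (x.val / s) (n / s - 1) with h | h
  · rw [min_eq_left h] at hj
    rw [hj] at h1
    nlinarith
  · rw [min_eq_right h] at hj
    have h4 : n / s + 1 = j + 2 := by omega
    rw [h4] at h3
    nlinarith

theorem card_intervalIndex_eq_le [NeZero n] {s : ℕ} (hs : 0 < s) (hq : 0 < n / s)
    (j : Fin (n / s)) :
    (Finset.univ.filter fun x : ZMod n => intervalIndex (s := s) hq x = j).card ≤ 2 * s := by
  have h : (Finset.Ico (j * s : ℕ) (j * s + 2 * s)).card = 2 * s := by simp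
  rw [← h]
  refine Finset.card_le_card_of_injOn ZMod.val ?_ (ZMod.val_injective n).injOn
  intro x hx
  simp only [Finset.coe_filter, Finset.mem_univ, true_and, Set.mem_ofPred_eq] at hx
  simpa using val_mem_of_intervalIndex_eq hs hq hx

theorem le_card_intervalIndex_eq [NeZero n] {s : ℕ} (hs : 0 < s) (hq : 0 < n / s)
    (j : Fin (n / s)) :
    s ≤ (Finset.univ.filter fun x : ZMod n => intervalIndex (s := s) hq x = j).card := by
  have hval : ∀ k ∈ Finset.range s, (((j * s + k : ℕ)) : ZMod n).val = j * s + k := by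
    intro k hk
    rw [Finset.mem_range] at hk
    refine ZMod.val_cast_of_lt ?_
    have h1 : (j + 1) * s ≤ n / s * s := Nat.mul_le_mul_right _ j.2
    have h2 : n / s * s ≤ n := Nat.div_mul_le_self _ _
    nlinarith
  conv_lhs => rw [← Finset.card_range s]
  refine Finset.card_le_card_of_injOn (fun k => ((j * s + k : ℕ) : ZMod n)) ?_ ?_
  · intro k hk
    rw [Finset.mem_coe] at hk
    simp only [Finset.coe_filter, Finset.mem_univ, true_and, Set.mem_ofPred_eq, intervalIndex,
      hval k hk, Fin.ext_iff]
    rw [Finset.mem_range] at hk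
    rw [mul_comm, Nat.mul_add_div hs, Nat.div_eq_of_lt hk]
    have := j.2
    omega
  · intro k hk l hl hkl
    have : (((j * s + k : ℕ)) : ZMod n).val = (((j * s + l : ℕ)) : ZMod n).val :=
      congrArg ZMod.val hkl
    rw [hval k hk, hval l hl] at this
    omega

/-- The index of the box of side about `s` that contains `v`. -/
def boxIndex {s q : ℕ} (hq : 0 < q) (v : Torus d n) : Fin d → Fin q :=
  fun i => intervalIndex (s := s) hq (v i)

open Classical in
theorem filter_boxIndex_eq [NeZero n] {s : ℕ} (hq : 0 < n / s) (j : Fin d → Fin (n / s)) :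
    (Finset.univ.filter fun v : Torus d n => boxIndex (s := s) hq v = j) =
      Fintype.piFinset fun i => Finset.univ.filter fun x : ZMod n =>
        intervalIndex (s := s) hq x = j i := by
  ext v
  simp [boxIndex, funext_iff]

open Classical in
theorem card_boxIndex_eq_le [NeZero n] {s : ℕ} (hs : 0 < s) (hq : 0 < n / s)
    (j : Fin d → Fin (n / s)) :
    (Finset.univ.filter fun v : Torus d n => boxIndex (s := s) hq v = j).card ≤ (2 * s) ^ d := by
  rw [filter_boxIndex_eq, Fintype.card_piFinset]
  refine (Finset.prod_le_pow_card _ _ (2 * s) fun i _ => ?_).trans_eq (by simp)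
  convert card_intervalIndex_eq_le hs hq (j i)

open Classical in
theorem le_card_boxIndex_eq [NeZero n] {s : ℕ} (hs : 0 < s) (hq : 0 < n / s)
    (j : Fin d → Fin (n / s)) :
    s ^ d ≤ (Finset.univ.filter fun v : Torus d n => boxIndex (s := s) hq v = j).card := by
  rw [filter_boxIndex_eq, Fintype.card_piFinset]
  refine le_trans (by simp) (Finset.pow_card_le_prod Finset.univ _ s fun i _ => ?_)
  convert le_card_intervalIndex_eq hs hq (j i)

theorem edist_le_of_boxIndex_eq [NeZero n] {s : ℕ} (hs : 0 < s) (hq : 0 < n / s)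
    {u v : Torus d n} (h : boxIndex (s := s) hq u = boxIndex (s := s) hq v) :
    (torusGraph d n).edist u v ≤ (d * (2 * s) : ℕ) := by
  have key : ∀ i, (v i).val ≤ (u i).val + 2 * s ∧ (u i).val ≤ (v i).val + 2 * s := by
    intro i
    have hu := val_mem_of_intervalIndex_eq hs hq (rfl : intervalIndex (s := s) hq (u i) = _)
    have hv := val_mem_of_intervalIndex_eq hs hq (congrFun h i).symm
    simp only [boxIndex] at hv
    omega
  exact edist_torusGraph_le (fun i => (key i).1) fun i => (key i).2

theorem diam_le_of_isBlockExpanding [NeZero n] {s J : ℕ} (hs : 0 < s) (hq : 0 < n / s) {c : ℝ}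
    (hc : 0 ≤ c) (hJ : (n : ℝ) ^ d < (1 + c) ^ J) {L : Set (Sym2 (Torus d n))}
    (hL : IsBlockExpanding (boxIndex (s := s) hq) c L) :
    (addLongEdges L).diam ≤ 2 * (d * (2 * s) + J * (d * (2 * s) + 1)) := by
  refine ENat.toNat_le_of_le_natCast (SimpleGraph.ediam_le_of_edist_le fun u v => ?_)
  refine edist_le_of_isBlockExpanding (b := boxIndex (s := s) hq)
    (fun u w h => (SimpleGraph.edist_anti le_sup_left).trans (edist_le_of_boxIndex_eq hs hq h))
    (fun u w h => ?_) hL hc ?_ u v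
  · rw [SimpleGraph.edist_le_one_iff_adj_or_eq, or_iff_not_imp_right]
    exact fun hne => (SimpleGraph.sup_adj _ _ _ _).2
      (Or.inr ((SimpleGraph.fromEdgeSet_adj _).2 ⟨h, hne⟩))
  · refine lt_of_le_of_lt ?_ hJ
    rw [Fintype.card_fun, Fintype.card_fin, Fintype.card_fin]
    exact_mod_cast Nat.pow_le_pow_left (Nat.div_le_self n s) d

end TorusBlocks

/-! ### Asymptotics of the upper bound -/

section UpperBoundLimit

theorem le_longProb {d n : ℕ} {σ ζ : ℝ} (hσ : 0 ≤ σ) (hζ : 0 ≤ ζ) (hn : 1 ≤ Real.log n)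
    (hσn : σ / (n : ℝ) ^ d ≤ 1) : σ / (n : ℝ) ^ d ≤ longProb d n σ ζ := by
  rw [longProb, Set.coe_projIcc]
  refine le_max_of_le_right (le_min hσn ?_)
  gcongr
  exact le_mul_of_one_le_right hσ (Real.one_le_rpow hn hζ)

theorem eventually_degree_bound {d : ℕ} {α β γ : ℝ} (hγ : γ < (2 * β) ^ d - (2 * α) ^ d) :
    ∀ᶠ n : ℕ in atTop, γ * (n : ℝ) ^ d ≤ (2 * β * n - 1) ^ d - (2 * α * n + 1) ^ d := by
  have h0 : Tendsto (fun n : ℕ => ((n : ℝ))⁻¹) atTop (𝓝 0) :=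
    tendsto_inv_atTop_zero.comp tendsto_natCast_atTop_atTop
  have h1 : Tendsto (fun n : ℕ => (2 * β - (n : ℝ)⁻¹) ^ d - (2 * α + (n : ℝ)⁻¹) ^ d) atTop
      (𝓝 ((2 * β) ^ d - (2 * α) ^ d)) := by
    simpa using ((h0.const_sub (2 * β)).pow d).sub ((h0.const_add (2 * α)).pow d)
  filter_upwards [h1.eventually (lt_mem_nhds hγ), eventually_ge_atTop 1] with n h hn
  have hn0 : (0 : ℝ) < n := by exact_mod_cast hn
  have h2 : 2 * β * n - 1 = (2 * β - (n : ℝ)⁻¹) * n := by field_simp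
  have h3 : 2 * α * n + 1 = (2 * α + (n : ℝ)⁻¹) * n := by field_simp
  rw [h2, h3, mul_pow, mul_pow, ← sub_mul]
  gcongr

/-- If every site is eligible for long edges to more than half of the sites, then the diameter is
at most of order `ln² n` for all nonnegative `ζ` and positive `σ`. -/
theorem exists_tendsto_probDiam_upper {d : ℕ} (hd : 1 ≤ d) {α β : ℝ} (hα : 0 < α)
    (hαβ : α < β) (hβ : β < 1 / 2) (hΓ : (2 * β) ^ d - (2 * α) ^ d > 1 / 2) {σ ζ : ℝ}
    (hσ : 0 < σ) (hζ : 0 ≤ ζ) :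
    ∃ C : ℝ, 0 < C ∧ ∀ k : ℕ, 2 ≤ k → Tendsto (fun n : ℕ => probDiam d n α β σ ζ
      (fun D => (D : ℝ) ≤ C * Real.log n ^ k)) atTop (𝓝 1) := by
  obtain ⟨γ, hγ1, hγ2⟩ := exists_between hΓ
  -- The margin `γ - 1/2 = 2 δ` covers the enlargement to `W`, at most `δ/2` since `c 2^d ≤ δ`, and
  -- leaves the fraction `δ` of partners outside.
  set δ := (γ - 1 / 2) / 2 with hδ
  have hδ0 : 0 < δ := by rw [hδ]; linarith
  set c := min 1 (δ / 2 ^ d)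
  have hc0 : 0 < c := lt_min one_pos (by positivity)
  have hc1 : c ≤ 1 := min_le_left _ _
  have hcK : c * 2 ^ d ≤ δ := (le_div_iff₀ (by positivity)).1 (min_le_right _ _)
  have hlogc : 0 < Real.log (1 + c) := Real.log_pos (by linarith)
  -- Box side `a ln n` gives `p s^d δ n^d ≥ 4 d ln n`, as the union bound requires; `h ln n` rounds
  -- suffice for `(1 + c)^J > n^d`.
  set a := 4 * d / (δ * σ) with ha
  set h := d / Real.log (1 + c) with hh
  have hd0 : (0 : ℝ) < d := by exact_mod_cast hd
  have ha0 : 0 < a := by positivity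
  have hh0 : 0 < h := by positivity
  refine ⟨12 * d * (h + 1) * (a + 1), by positivity, fun k hk => ?_⟩
  have hcast : Tendsto (fun n : ℕ => (n : ℝ)) atTop atTop := tendsto_natCast_atTop_atTop
  have hlow : Tendsto (fun n : ℕ => 1 - Real.exp 2 / n) atTop (𝓝 1) := by
    simpa using (tendsto_const_div_atTop_nhds_zero_nat (Real.exp 2)).const_sub 1
  refine tendsto_of_tendsto_of_tendsto_of_le_of_le' hlow tendsto_const_nhds ?_ ?_
  swap
  · filter_upwards [eventually_ge_atTop 1] with n hn
    have : NeZero n := ⟨by omega⟩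
    exact measureReal_le_one (μ := setBernoulli _ _)
  filter_upwards [eventually_degree_bound hγ2, eventually_ge_atTop 1,
    (Real.tendsto_log_atTop.comp hcast).eventually_ge_atTop 1, hcast.eventually_ge_atTop σ,
    hcast.eventually_ge_atTop (1 / (2 * β)),
    (Real.isLittleO_log_id_atTop.comp_tendsto hcast).bound
      (show 0 < 1 / (a + 1) by positivity)] with n hdeg hn hlog hσn hβn hloglt
  have : NeZero n := ⟨by omega⟩
  simp only [Function.comp, id, Real.norm_eq_abs] at hlog hloglt
  have hn1 : (1 : ℝ) ≤ n := by exact_mod_cast hn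
  have hn0 : (0 : ℝ) < n := by linarith
  have hlog0 : 0 < Real.log n := by linarith
  rw [abs_of_pos hlog0, abs_of_pos hn0, one_div, ← div_eq_inv_mul,
    le_div_iff₀ (by positivity)] at hloglt
  set s := ⌈a * Real.log n⌉₊
  have hs_lo : a * Real.log n ≤ s := Nat.le_ceil _
  have hs_hi : (s : ℝ) ≤ (a + 1) * Real.log n := by
    have := Nat.ceil_lt_add_one (show 0 ≤ a * Real.log n by positivity)
    linarith
  have hs0 : 0 < s := Nat.ceil_pos.2 (by positivity)
  have hsn : s ≤ n := by
    have : (s : ℝ) ≤ n := by linarith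
    exact_mod_cast this
  have hq : 0 < n / s := Nat.div_pos hsn hs0
  set J := ⌊h * Real.log n⌋₊ + 1
  have hJ : (n : ℝ) ^ d < (1 + c) ^ J := by
    rw [← Real.log_lt_log_iff (by positivity) (by positivity), Real.log_pow, Real.log_pow,
      ← div_lt_iff₀ hlogc]
    have := Nat.lt_floor_add_one (h * Real.log n)
    simp only [J]
    push_cast
    refine lt_of_le_of_lt (le_of_eq ?_) this
    rw [hh]
    ring
  have hJ_hi : (J : ℝ) ≤ (h + 1) * Real.log n := by
    have := Nat.floor_le (show 0 ≤ h * Real.log n by positivity)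
    simp only [J]
    push_cast
    linarith
  have hbound : ((2 * (d * (2 * s) + J * (d * (2 * s) + 1)) : ℕ) : ℝ) ≤
      12 * d * (h + 1) * (a + 1) * Real.log n ^ k := by
    have h1 : 2 * (d * (2 * s) + J * (d * (2 * s) + 1)) ≤ 12 * d * (J * s) := by
      have hJ1 : 1 ≤ J := Nat.succ_pos _
      have hds : 1 ≤ d * s := Nat.mul_pos hd hs0
      nlinarith
    calc ((2 * (d * (2 * s) + J * (d * (2 * s) + 1)) : ℕ) : ℝ) ≤ (12 * d * (J * s) : ℕ) := by
          exact_mod_cast h1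
      _ = 12 * d * ((J : ℝ) * s) := by push_cast; ring
      _ ≤ 12 * d * (((h + 1) * Real.log n) * ((a + 1) * Real.log n)) := by gcongr
      _ = 12 * d * (h + 1) * (a + 1) * Real.log n ^ 2 := by ring
      _ ≤ _ := by gcongr
  have hpn : σ / (n : ℝ) ^ d ≤ longProb d n σ ζ := by
    refine le_longProb hσ.le hζ hlog ((div_le_one (by positivity)).2 (hσn.trans ?_))
    exact le_self_pow₀ hn1 (by omega)
  have hcard : (Fintype.card (Torus d n) : ℝ) = (n : ℝ) ^ d := by
    rw [card_torus]; push_cast; rfl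
  have hprob := prob_not_isBlockExpanding_le (longPairs d n α β)
    (boxIndex (s := s) hq : Torus d n → Fin d → Fin (n / s)) (longProb d n σ ζ)
    (c := c) (γ := γ) (δ := δ) (K := 2 ^ d) (m := (s : ℝ) ^ d) hc0.le hc1 (by positivity)
    hδ0.le (by linarith) (by positivity)
    (fun i => by
      rw [← Nat.cast_pow, Nat.cast_le]
      convert le_card_boxIndex_eq hs0 hq i)
    (fun i => by
      rw [← mul_pow, ← Nat.cast_ofNat, ← Nat.cast_mul, ← Nat.cast_pow, Nat.cast_le]
      convert card_boxIndex_eq_le hs0 hq i)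
    (fun v => by
      rw [hcard]
      refine hdeg.trans (le_card_longPairs_adj hα (by linarith) hβ ?_ v)
      rwa [div_le_iff₀' (by linarith)] at hβn)
    (by rw [card_torus]; exact Nat.one_le_pow _ _ hn)
    (by
      rw [card_torus, Fintype.card_fun, Fintype.card_fin, Fintype.card_fin]
      exact Nat.pow_le_pow_left (Nat.div_le_self n s) d)
    (by
      rw [hcard, Real.log_pow]
      calc 4 * (d * Real.log n) = δ * σ * (a * Real.log n) := by rw [ha]; field_simp
        _ ≤ δ * σ * s := by gcongr
        _ ≤ δ * σ * (s : ℝ) ^ d := by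
            gcongr
            exact le_self_pow₀ (by exact_mod_cast hs0) (by omega)
        _ = σ / (n : ℝ) ^ d * ((s : ℝ) ^ d * (δ * (n : ℝ) ^ d)) := by field_simp
        _ ≤ _ := by gcongr)
  have hbad : Real.exp 2 / Fintype.card (Torus d n) ≤ Real.exp 2 / n := by
    rw [hcard]
    gcongr
    exact le_self_pow₀ hn1 (by omega)
  have hgood := probReal_compl_eq_one_sub
    (μ := setBernoulli (longPairs d n α β).edgeSet (longProb d n σ ζ))
    (s := {L | ¬ IsBlockExpanding (boxIndex (s := s) hq) c L}) (Set.toFinite _).measurableSet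
  refine (by linarith : _ ≤ _).trans (hgood.symm.le.trans ?_)
  refine measureReal_mono (μ := setBernoulli _ _) ?_
  intro L hL
  have hL' : IsBlockExpanding (boxIndex (s := s) hq) c L := not_not.1 hL
  exact le_trans (by exact_mod_cast diam_le_of_isBlockExpanding hs0 hq hc0.le hJ hL') hbound

end UpperBoundLimit

end ModifiedNewmanWatts

/-! ### Assembly of the two bounds -/

theorem theorem1 (d : ℕ) (hd : 1 ≤ d) (α β : ℝ) (hα : 0 < α) (hαβ : α < β) (hβ : β < 1 / 2) :
    -- Part A
    ((2 * β) ^ d - (2 * α) ^ d > 1 / 2 →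
      -- (i)
      ((∀ ζ : ℝ, 0 < ζ → ζ < 1 → ∀ σ : ℝ, 0 < σ → ∃ C₁ : ℝ, 0 < C₁ ∧
          Tendsto (fun n : ℕ => ModifiedNewmanWatts.probDiam d n α β σ ζ
            (fun D => (D : ℝ) ≤ C₁ * Real.log n ^ 3)) atTop (𝓝 1)) ∧
        (∃ σ₀ : ℝ, 0 < σ₀ ∧ ∀ σ : ℝ, σ₀ ≤ σ → ∃ C₁ : ℝ, 0 < C₁ ∧
          Tendsto (fun n : ℕ => ModifiedNewmanWatts.probDiam d n α β σ 0
            (fun D => (D : ℝ) ≤ C₁ * Real.log n ^ 3)) atTop (𝓝 1))) ∧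
      -- (ii)
      ((∀ ζ : ℝ, 1 < ζ → ∀ σ : ℝ, 0 < σ → ∃ C₂ : ℝ, 0 < C₂ ∧
          Tendsto (fun n : ℕ => ModifiedNewmanWatts.probDiam d n α β σ ζ
            (fun D => (D : ℝ) ≤ C₂ * Real.log n ^ 2)) atTop (𝓝 1)) ∧
        (∃ σ₀ : ℝ, 0 < σ₀ ∧ ∀ σ : ℝ, σ₀ ≤ σ → ∃ C₂ : ℝ, 0 < C₂ ∧
          Tendsto (fun n : ℕ => ModifiedNewmanWatts.probDiam d n α β σ 1
            (fun D => (D : ℝ) ≤ C₂ * Real.log n ^ 2)) atTop (𝓝 1)))) ∧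
    -- Part B
    (∀ ζ : ℝ, ζ < 1 →
      (∀ σ : ℝ, 0 < σ → ∀ ν : ℝ, 0 < ν → ν < (1 - ζ) / d →
        Tendsto (fun n : ℕ => ModifiedNewmanWatts.probDiam d n α β σ ζ
          (fun D => Real.log n ^ ν ≤ (D : ℝ))) atTop (𝓝 1)) ∧
      (∃ σ₀ : ℝ, 0 < σ₀ ∧ ∀ σ : ℝ, 0 < σ → σ ≤ σ₀ →
        Tendsto (fun n : ℕ => ModifiedNewmanWatts.probDiam d n α β σ ζ
          (fun D => Real.log n ^ ((1 - ζ) / d) ≤ (D : ℝ))) atTop (𝓝 1))) := by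
  have hd0 : (0 : ℝ) < d := by exact_mod_cast hd
  have hlog : Tendsto (fun n : ℕ => Real.log n) atTop atTop :=
    Real.tendsto_log_atTop.comp tendsto_natCast_atTop_atTop
  refine ⟨fun hΓ => ?_, fun ζ hζ => ⟨fun σ hσ ν hν0 hν => ?_, ?_⟩⟩
  · have upper : ∀ k : ℕ, 2 ≤ k → ∀ ζ : ℝ, 0 ≤ ζ → ∀ σ : ℝ, 0 < σ → ∃ C : ℝ, 0 < C ∧
        Tendsto (fun n : ℕ => ModifiedNewmanWatts.probDiam d n α β σ ζ
          (fun D => (D : ℝ) ≤ C * Real.log n ^ k)) atTop (𝓝 1) := by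
      intro k hk ζ hζ σ hσ
      obtain ⟨C, hC, h⟩ :=
        ModifiedNewmanWatts.exists_tendsto_probDiam_upper hd hα hαβ hβ hΓ hσ hζ
      exact ⟨C, hC, h k hk⟩
    -- The bound holds for every positive `σ`, so the threshold `1` is an arbitrary choice.
    exact ⟨⟨fun ζ hζ _ => upper 3 (by norm_num) ζ hζ.le,
      1, one_pos, fun σ hσ => upper 3 (by norm_num) 0 le_rfl σ (by linarith)⟩,
      fun ζ hζ => upper 2 le_rfl ζ (by linarith),
      1, one_pos, fun σ hσ => upper 2 le_rfl 1 zero_le_one σ (by linarith)⟩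
  · refine ModifiedNewmanWatts.tendsto_probDiam_lower hd β hα hσ hν0 ?_
    -- Below the critical exponent the growth condition compares a power of `ln n` less than one
    -- with `ln n`, so any `σ` works.
    have hθ : ν * d + ζ < 1 := by
      rw [lt_div_iff₀ hd0] at hν
      linarith
    have hpow := ((tendsto_rpow_atTop (sub_pos.2 hθ)).comp hlog).eventually_ge_atTop
      (8 * (σ * 3 ^ d))
    filter_upwards [hpow, hlog.eventually_gt_atTop 0] with n h hn
    have hsplit : Real.log n ^ (ν * d + ζ) * Real.log n ^ (1 - (ν * d + ζ)) = Real.log n := by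
      rw [← Real.rpow_add hn, add_sub_cancel, Real.rpow_one]
    have := mul_le_mul_of_nonneg_left h (Real.rpow_nonneg hn.le (ν * d + ζ))
    simp only [Function.comp, hsplit] at this
    linarith
  · refine ⟨1 / (8 * 3 ^ d), by positivity, fun σ hσ hσ₀ => ?_⟩
    refine ModifiedNewmanWatts.tendsto_probDiam_lower hd β hα hσ
      (div_pos (by linarith) hd0) ?_
    filter_upwards [hlog.eventually_gt_atTop 0] with n hn
    rw [div_mul_cancel₀ _ hd0.ne', sub_add_cancel, Real.rpow_one]
    calc σ * 3 ^ d * Real.log n ≤ 1 / (8 * 3 ^ d) * 3 ^ d * Real.log n := by gcongr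
      _ = Real.log n / 8 := by field_simp
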